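/- \textbf{Theorem.} There are a function $\nu:(0,\infty)^2\to(0,\infty)$ and an absolute constant $c>0$ with $\nu(\alpha,\beta)\le \frac{c}{\beta\alpha^{3}}$ for all $\alpha,\beta>0$ such that the following holds for all $\alpha,\beta>0$. Let $P\subset\mathbb{R}^2$ be an $(\alpha,\beta)$-covered polygonal domain, possibly with holes, and let $R\subseteq P$ be a geodesically convex set in $P$ such that $\partial R\setminus\partial P$ is polygonal. Then $$\mathrm{per}(R)\;\le\;\nu(\alpha,\beta)\cdot \mathrm{diam}(R).$$ Here a \emph{polygonal domain} (possibly with holes) is a compact connected set $P\subset\mathbb{R}^2$ that is the closure of its interior and whose boundary $\partial P$ is a union of finitely many line segments. It is \emph{$(\alpha,\beta)$-covered} if every $p\in\partial P$ is a vertex of a non-degenerate triangle $T_p\subseteq P$ all of whose angles are at least $\alpha$ and all of whose sides have length at least $\beta\cdot\mathrm{diam}(P)$. A set $R\subseteq P$ is \emph{geodesically convex} in $P$ if any two points $p,q\in R$ are joined by a shortest path inside $P$ that is contained in $R$ (if there are several shortest paths, it suffices that one of them is contained in $R$). That $\partial R\setminus\partial P$ is \emph{polygonal} means that its closure is a union of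 finitely many (possibly degenerate) line segments. Finally, $\mathrm{diam}$ denotes the Euclidean diameter, and $\mathrm{per}(R)$ is the length (one-dimensional Hausdorff measure) of $\partial R$. -/

import Mathlib

open MeasureTheory
open scoped ENNReal EuclideanGeometry

noncomputable section

namespace FatDomain

/-- The Euclidean plane. -/
abbrev Plane : Type := EuclideanSpace ℝ (Fin 2)

/-- A set is polygonal (as a one-dimensional set) if it is the union of finitely many closed
line segments; segments of length zero, and the empty union, are allowed. -/
def IsSegmentUnion (A : Set Plane) : Prop :=
  ∃ S : Finset (Plane × Plane), A = ⋃ s ∈ S, segment ℝ s.1 s.2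

/-- A polygonal domain, possibly with holes: a compact connected region of the plane that is the
closure of its interior and whose boundary consists of finitely many line segments. -/
structure IsPolygonalDomain (P : Set Plane) : Prop where
  isCompact : IsCompact P
  isConnected : IsConnected P
  closure_interior : closure (interior P) = P
  boundary : IsSegmentUnion (frontier P)

/-- The (nondegenerate) triangle with vertices `a`, `b`, `c` is `α`-fat: each of its angles is at
least `α`. -/
def IsFatTriangle (α : ℝ) (a b c : Plane) : Prop :=
  AffineIndependent ℝ ![a, b, c] ∧ α ≤ ∠ b a c ∧ α ≤ ∠ a b c ∧ α ≤ ∠ a c b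

/-- `P` is `(α, β)`-covered: every boundary point `p` is a vertex of an `α`-fat triangle contained
in `P` all of whose sides have length at least `β` times the Euclidean diameter of `P`. -/
def IsCovered (α β : ℝ) (P : Set Plane) : Prop :=
  ∀ p ∈ frontier P, ∃ a b : Plane,
    IsFatTriangle α p a b ∧ convexHull ℝ {p, a, b} ⊆ P ∧
      β * Metric.diam P ≤ dist p a ∧ β * Metric.diam P ≤ dist p b ∧ β * Metric.diam P ≤ dist a b

/-- The length (total variation) of a path in the plane, possibly infinite. -/
def pathLength {p q : Plane} (γ : Path p q) : ℝ≥0∞ :=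
  eVariationOn (fun t => γ t) Set.univ

/-- `γ` is a shortest path inside `P` between its endpoints. -/
def IsShortestPathIn (P : Set Plane) {p q : Plane} (γ : Path p q) : Prop :=
  Set.range γ ⊆ P ∧ ∀ γ' : Path p q, Set.range γ' ⊆ P → pathLength γ ≤ pathLength γ'

/-- `R` is a geodesically convex subset of `P`: any two points of `R` are joined by a path that is
a shortest path inside `P` and that is contained in `R`. (Where shortest paths are not unique,
only one of them is required to lie in `R`.) -/
def IsGeodesicallyConvexIn (P R : Set Plane) : Prop :=
  R ⊆ P ∧ ∀ p ∈ R, ∀ q ∈ R, ∃ γ : Path p q, IsShortestPathIn P γ ∧ Set.range γ ⊆ R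

/-- The perimeter of a set: the length (one-dimensional Hausdorff measure) of its boundary. -/
def perimeter (R : Set Plane) : ℝ≥0∞ :=
  Measure.hausdorffMeasure 1 (frontier R)

end FatDomain

end

/-! Let K be the closed convex hull of R; it has the same diameter d. Split ∂R into E = ∂R \ ∂P and
a rest lying in F = ∂P ∩ K. Two estimates suffice: the length of E is controlled by that of F plus
d, and the length of F is O(d / (βα³)).

For E, count points on axis-parallel lines. If x, y, z in E are met in this order on such a line and
the segment xz avoids ∂P, then xz lies in the interior of P. Near xz the set R is honestly convex,
so three collinear boundary points force xz ⊆ ∂R. That gives infinitely many points of E on the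
line, which happens only for a null set of lines. Hence almost every line has a point of F between x
and z, and it meets E at most 2(#F + 1) times (`IsGeodesicallyConvexIn.crossings_le`). Integrating
over both coordinate directions, a crude Crofton formula, turns counts into lengths
(`HasCrossingBounds`).

For F, the fat triangle at p ∈ ∂P contains a disc, and by convexity the cone from p over that disc;
its interior contains no point of ∂P. Classify the points of ∂P by axis, sign and rounded slope of
the cone, and by slabs no thicker than the cone height. Each class in K is a Lipschitz graph of
length O(d/κ), κ = (sin α)/6. There are O(1/κ) slopes and O(1/(κβ)) slabs
(`HasEmptyCones.hausdorffMeasure_le`). -/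

namespace FatDomain

/-! ### Shortest paths along straight segments -/

theorem pathLength_segment_le (p q : Plane) : pathLength (Path.segment p q) ≤ edist p q := by
  have hL : LipschitzWith (nndist p q) (fun t : ℝ => AffineMap.lineMap p q t) := by
    refine LipschitzWith.of_dist_le_mul fun x y => ?_
    rw [dist_lineMap_lineMap, mul_comm, coe_nndist]
  have h1 : pathLength (Path.segment p q) =
      eVariationOn ((fun t : ℝ => AffineMap.lineMap p q t) ∘ (fun t : unitInterval => (t : ℝ)))
        Set.univ := by
    unfold pathLength
    congr 1
  rw [h1]
  refine (hL.lipschitzOnWith (s := Set.univ)).comp_eVariationOn_le (Set.mapsTo_univ _ _) |>.trans ?_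
  have hm : eVariationOn (fun t : unitInterval => (t : ℝ)) Set.univ ≤ 1 := by
    have := MonotoneOn.eVariationOn_eq (f := fun t : unitInterval => (t : ℝ)) (s := Set.univ)
      (a := 0) (b := 1) (fun x _ y _ h => h) trivial trivial
    have hI : (Set.univ : Set unitInterval) ∩ Set.Icc 0 1 = Set.univ := by
      ext x; simp [unitInterval.le_one']
    rw [hI] at this
    rw [this]; simp
  calc _ ≤ ((nndist p q : NNReal) : ℝ≥0∞) * 1 := by gcongr
    _ = edist p q := by rw [mul_one, edist_nndist]

theorem edist_add_edist_le_pathLength {p q : Plane} (γ : Path p q) (t : unitInterval) :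
    edist p (γ t) + edist (γ t) q ≤ pathLength γ := by
  have h := eVariationOn.add_le_union (fun s => γ s) (s := Set.Iic t) (t := Set.Ici t)
    (fun x hx y hy => le_trans hx hy)
  rw [Set.Iic_union_Ici] at h
  refine le_trans (add_le_add ?_ ?_) h
  · simpa using eVariationOn.edist_le (fun s => γ s) (s := Set.Iic t) (x := 0) (y := t)
      unitInterval.nonneg' Set.self_mem_Iic
  · simpa using eVariationOn.edist_le (fun s => γ s) (s := Set.Ici t) (x := t) (y := 1)
      Set.self_mem_Ici unitInterval.le_one'

/-- Equality in the triangle inequality puts every point of γ on the segment. By the intermediate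
value theorem the distance to p takes every value up to |pq|, and on the segment that distance
determines the point. -/
theorem segment_subset_range_of_pathLength_le {p q : Plane} (γ : Path p q)
    (h : pathLength γ ≤ edist p q) : segment ℝ p q ⊆ Set.range γ := by
  have hw : ∀ t, dist p (γ t) + dist (γ t) q = dist p q := by
    intro t
    refine le_antisymm ?_ (dist_triangle _ _ _)
    have := (edist_add_edist_le_pathLength γ t).trans h
    rw [edist_dist, edist_dist, edist_dist, ← ENNReal.ofReal_add dist_nonneg dist_nonneg] at this
    exact (ENNReal.ofReal_le_ofReal_iff dist_nonneg).1 this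
  intro z hz
  have hz' : dist p z + dist z q = dist p q := dist_add_dist_of_mem_segment hz
  have hc : Continuous fun t => dist p (γ t) := by fun_prop
  obtain ⟨t, ht⟩ := mem_range_of_exists_le_of_exists_ge hc (c := dist p z)
    ⟨0, by simp⟩ ⟨1, by simp only [Path.target]; linarith [dist_nonneg (x := z) (y := q)]⟩
  refine ⟨t, ?_⟩
  have hs : γ t ∈ segment ℝ p q := by
    rw [mem_segment_iff_wbtw, ← dist_add_dist_eq_iff]; exact hw t
  rw [segment_eq_image_lineMap] at hz hs
  obtain ⟨a, ha, rfl⟩ := hz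
  obtain ⟨b, hb, hb'⟩ := hs
  simp only at ht
  rw [← hb', dist_left_lineMap, dist_left_lineMap, Real.norm_of_nonneg ha.1,
    Real.norm_of_nonneg hb.1] at ht
  rw [← hb']
  rcases eq_or_ne p q with rfl | hne
  · simp
  · rw [mul_right_cancel₀ (dist_ne_zero.2 hne) ht]

theorem IsGeodesicallyConvexIn.segment_subset {P R : Set Plane}
    (hR : IsGeodesicallyConvexIn P R) {p q : Plane} (hp : p ∈ R) (hq : q ∈ R)
    (h : segment ℝ p q ⊆ P) : segment ℝ p q ⊆ R := by
  obtain ⟨γ, ⟨_, hγ⟩, hγR⟩ := hR.2 p hp q hq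
  have hr : Set.range (Path.segment p q) = segment ℝ p q := by
    simp
  exact (segment_subset_range_of_pathLength_le γ
    ((hγ (Path.segment p q) (hr ▸ h)).trans (pathLength_segment_le p q))).trans hγR

/-! ### Local convexity away from ∂P -/

/-- If some w on the segment were interior to C, the open segments from w to both ends would be
interior too, and y is w or lies on one of them. -/
theorem Convex.segment_subset_frontier {C : Set Plane} (hC : Convex ℝ C) {x y z : Plane}
    (hx : x ∈ frontier C) (hy : y ∈ frontier C) (hz : z ∈ frontier C)
    (hyo : y ∈ openSegment ℝ x z) : segment ℝ x z ⊆ frontier C := by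
  intro w hw
  refine ⟨hC.closure.segment_subset hx.1 hz.1 hw, fun hi => ?_⟩
  have hwx : w ≠ x := fun h => hx.2 (h ▸ hi)
  have hwz : w ≠ z := fun h => hz.2 (h ▸ hi)
  have h1 : openSegment ℝ w x ⊆ interior C :=
    hC.openSegment_interior_closure_subset_interior hi hx.1
  have h2 : openSegment ℝ w z ⊆ interior C :=
    hC.openSegment_interior_closure_subset_interior hi hz.1
  have hwo : w ∈ openSegment ℝ x z := by
    rw [← insert_endpoints_openSegment] at hw
    rcases hw with h | h | h
    exacts [absurd h hwx, absurd h hwz, h]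
  rcases openSegment_subset_union (𝕜 := ℝ) x z (z := w)
      (openSegment_subset_segment ℝ x z hwo |> fun h => by
        rw [segment_eq_image_lineMap] at h; obtain ⟨a, _, h⟩ := h; exact ⟨a, h⟩) hyo with h | h | h
  · exact hy.2 (h ▸ hi)
  · exact hy.2 (h1 (openSegment_symm ℝ x w ▸ h))
  · exact hy.2 (h2 h)

theorem segment_subset_interior_of_disjoint_frontier {P : Set Plane} (hP : IsClosed P)
    {x z : Plane} (hx : x ∈ P) (h : Disjoint (segment ℝ x z) (frontier P)) :
    segment ℝ x z ⊆ interior P := by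
  have hsub : segment ℝ x z ⊆ interior P ∪ Pᶜ := by
    intro w hw
    by_cases hwP : w ∈ P
    · left
      by_contra hi
      exact Set.disjoint_left.1 h hw ⟨subset_closure hwP, hi⟩
    · exact Or.inr hwP
  refine (convex_segment x z).isPreconnected.subset_left_of_subset_union isOpen_interior
    hP.isOpen_compl ?_ hsub ⟨x, left_mem_segment ℝ x z, ?_⟩
  · exact Set.disjoint_left.2 fun w hw hw' => hw' (interior_subset hw)
  · by_contra hi
    exact Set.disjoint_left.1 h (left_mem_segment ℝ x z) ⟨subset_closure hx, hi⟩

/-- The segment lies in the interior of P, and by compactness so does a convex open neighbourhood U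
of it. There geodesics are straight, so R ∩ U is convex, and inside U its frontier is that of R. -/
theorem IsGeodesicallyConvexIn.segment_subset_frontier {P R : Set Plane} (hP : IsClosed P)
    (hR : IsGeodesicallyConvexIn P R) {x y z : Plane} (hx : x ∈ frontier R)
    (hy : y ∈ frontier R) (hz : z ∈ frontier R) (hyo : y ∈ openSegment ℝ x z)
    (h : Disjoint (segment ℝ x z) (frontier P)) : segment ℝ x z ⊆ frontier R := by
  have hxP : x ∈ P := closure_minimal hR.1 hP hx.1
  have hsub := segment_subset_interior_of_disjoint_frontier hP hxP h
  have hcpt : IsCompact (segment ℝ x z) := by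
    rw [segment_eq_image_lineMap]
    exact isCompact_Icc.image AffineMap.lineMap_continuous
  obtain ⟨δ, hδ, hU⟩ := hcpt.exists_thickening_subset_open isOpen_interior hsub
  set U := Metric.thickening δ (segment ℝ x z) with hUdef
  have hUo : IsOpen U := Metric.isOpen_thickening
  have hUc : Convex ℝ U := (convex_segment x z).thickening δ
  have hsU : segment ℝ x z ⊆ U := Metric.self_subset_thickening hδ _
  have hC : Convex ℝ (R ∩ U) := by
    rw [convex_iff_segment_subset]
    intro p hp q hq
    have hpq := hUc.segment_subset hp.2 hq.2
    exact Set.subset_inter (hR.segment_subset hp.1 hq.1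
      (hpq.trans (hU.trans interior_subset))) hpq
  have hfr : ∀ w ∈ U, (w ∈ frontier (R ∩ U) ↔ w ∈ frontier R) := by
    intro w hw
    have := frontier_inter_open_inter (s := R) hUo
    constructor
    · intro h'
      exact ((this ▸ (⟨h', hw⟩ : w ∈ frontier (R ∩ U) ∩ U) : w ∈ frontier R ∩ U)).1
    · intro h'
      exact ((this ▸ (⟨h', hw⟩ : w ∈ frontier R ∩ U) : w ∈ frontier (R ∩ U) ∩ U)).1
  have hyS := openSegment_subset_segment ℝ x z hyo
  intro w hw
  exact (hfr w (hsU hw)).1 (Convex.segment_subset_frontier hC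
    ((hfr x (hsU (left_mem_segment ℝ x z))).2 hx) ((hfr y (hsU hyS)).2 hy)
    ((hfr z (hsU (right_mem_segment ℝ x z))).2 hz) hyo hw)

/-! ### Length and crossing counts of subsets of segment unions -/

/-- If a real-valued function expands distances on `A` up to the factor `M`, the length of `A` is
at most `M` times the measure of its image. -/
theorem hausdorffMeasure_one_le_mul_volume_image {A : Set Plane} {f : Plane → ℝ} {M : NNReal}
    (h : ∀ p ∈ A, ∀ q ∈ A, dist p q ≤ M * |f p - f q|) :
    Measure.hausdorffMeasure 1 A ≤ M * volume (f '' A) := by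
  have hinj : Set.InjOn f A := by
    intro p hp q hq hpq
    have := h p hp q hq
    rw [hpq, sub_self, abs_zero, mul_zero] at this
    exact dist_le_zero.1 this
  have hL : LipschitzOnWith M (Function.invFunOn f A) (f '' A) := by
    refine LipschitzOnWith.of_dist_le_mul ?_
    rintro _ ⟨p, hp, rfl⟩ _ ⟨q, hq, rfl⟩
    rw [hinj.leftInvOn_invFunOn hp, hinj.leftInvOn_invFunOn hq, Real.dist_eq]
    exact h p hp q hq
  have := hL.hausdorffMeasure_image_le (d := 1) zero_le_one
  rw [hinj.leftInvOn_invFunOn.image_image] at this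
  simpa [hausdorffMeasure_real] using this

theorem abs_coord_sub_le_dist (p q : Plane) (i : Fin 2) : |p i - q i| ≤ dist p q := by
  rw [dist_eq_norm]
  exact PiLp.norm_apply_le (p - q) i

theorem dist_le_abs_add_abs {i j : Fin 2} (hij : i ≠ j) (p q : Plane) :
    dist p q ≤ |p i - q i| + |p j - q j| := by
  rw [EuclideanSpace.dist_eq]
  have : ∑ k, dist (p k) (q k) ^ 2 = |p i - q i| ^ 2 + |p j - q j| ^ 2 := by
    simp only [Real.dist_eq, Fin.sum_univ_two]
    fin_cases i <;> fin_cases j <;> simp at hij ⊢; ring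
  rw [this]
  refine Real.sqrt_le_iff.2 ⟨by positivity, ?_⟩
  nlinarith [abs_nonneg (p i - q i), abs_nonneg (p j - q j)]

theorem volume_image_coord_le (A : Set Plane) (i : Fin 2) :
    volume ((fun p : Plane => p i) '' A) ≤ Measure.hausdorffMeasure 1 A := by
  have hL : LipschitzWith 1 (fun p : Plane => p i) :=
    LipschitzWith.of_dist_le_mul fun p q => by
      simpa [Real.dist_eq] using abs_coord_sub_le_dist p q i
  have := hL.hausdorffMeasure_image_le (d := 1) zero_le_one A
  simpa [hausdorffMeasure_real] using this

/-- The number of points of `A` on the line on which the `i`-th coordinate equals `t`. -/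
noncomputable def crossings (A : Set Plane) (i : Fin 2) (t : ℝ) : ℝ≥0∞ :=
  Measure.count (A ∩ {p : Plane | p i = t})

theorem injOn_coord_segment {a b : Plane} {i : Fin 2} (h : a i ≠ b i) :
    Set.InjOn (fun p : Plane => p i) (segment ℝ a b) := by
  rw [segment_eq_image_lineMap]
  rintro _ ⟨u, _, rfl⟩ _ ⟨v, _, rfl⟩ huv
  simp only [AffineMap.lineMap_apply, vsub_eq_sub, vadd_eq_add, PiLp.add_apply, PiLp.smul_apply,
    PiLp.sub_apply, smul_eq_mul, add_left_inj] at huv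
  rw [mul_right_cancel₀ (sub_ne_zero.2 h.symm) huv]

theorem coord_eq_of_mem_segment {a b p : Plane} {i : Fin 2} (h : a i = b i)
    (hp : p ∈ segment ℝ a b) : p i = a i := by
  rw [segment_eq_image_lineMap] at hp
  obtain ⟨u, _, rfl⟩ := hp
  simp [AffineMap.lineMap_apply, h]

theorem measurableSet_image_coord {A : Set Plane} (hA : MeasurableSet A) {a b : Plane}
    (h : A ⊆ segment ℝ a b) (i : Fin 2) : MeasurableSet ((fun p : Plane => p i) '' A) := by
  by_cases hab : a i = b i
  · refine Set.Subsingleton.measurableSet ?_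
    rintro _ ⟨p, hp, rfl⟩ _ ⟨q, hq, rfl⟩
    simp only [coord_eq_of_mem_segment hab (h hp), coord_eq_of_mem_segment hab (h hq)]
  · exact hA.image_of_continuousOn_injOn (by fun_prop) ((injOn_coord_segment hab).mono h)

/-- Only a segment contained in the line can meet it twice; the excluded value t = a i rules this
out and is negligible for integration. -/
theorem crossings_eq_indicator {A : Set Plane} {a b : Plane}
    (h : A ⊆ segment ℝ a b) (i : Fin 2) {t : ℝ} (ht : t ≠ a i) :
    crossings A i t = ((fun p : Plane => p i) '' A).indicator 1 t := by
  have hs : (A ∩ {p : Plane | p i = t}).Subsingleton := by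
    rintro p ⟨hp, hpt⟩ q ⟨hq, hqt⟩
    by_cases hab : a i = b i
    · exact absurd (hpt.symm.trans (coord_eq_of_mem_segment hab (h hp))) ht
    · exact injOn_coord_segment hab (h hp) (h hq) (hpt.trans hqt.symm)
  unfold crossings
  rcases hs.eq_empty_or_singleton with h0 | ⟨p, hp⟩
  · rw [h0, measure_empty, Set.indicator_of_notMem]
    rintro ⟨p, hp, hpt⟩
    exact (h0 ▸ (⟨hp, hpt⟩ : p ∈ A ∩ {p : Plane | p i = t}) : p ∈ (∅ : Set Plane))
  · rw [hp, Measure.count_singleton, Set.indicator_of_mem]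
    · rfl
    · have : p ∈ A ∩ {p : Plane | p i = t} := hp ▸ rfl
      exact ⟨p, this.1, this.2⟩

theorem exists_coord_dist_le (a b : Plane) : ∃ i : Fin 2, dist a b ≤ 2 * |a i - b i| := by
  have := dist_le_abs_add_abs (i := 0) (j := 1) (by decide) a b
  rcases le_total |a 0 - b 0| |a 1 - b 1| with h | h
  · exact ⟨1, by linarith⟩
  · exact ⟨0, by linarith⟩

theorem exists_hausdorffMeasure_le_of_subset_segment {A : Set Plane} {a b : Plane}
    (h : A ⊆ segment ℝ a b) :
    ∃ i : Fin 2, Measure.hausdorffMeasure 1 A ≤ 2 * volume ((fun p : Plane => p i) '' A) := by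
  obtain ⟨i, hi⟩ := exists_coord_dist_le a b
  refine ⟨i, hausdorffMeasure_one_le_mul_volume_image (M := 2) fun p hp q hq => ?_⟩
  have hp' := h hp
  have hq' := h hq
  rw [segment_eq_image_lineMap] at hp' hq'
  obtain ⟨u, _, rfl⟩ := hp'
  obtain ⟨v, _, rfl⟩ := hq'
  rw [dist_lineMap_lineMap]
  have : (AffineMap.lineMap a b u : Plane) i - (AffineMap.lineMap a b v : Plane) i
      = (u - v) * (b i - a i) := by
    simp [AffineMap.lineMap_apply]; ring
  rw [this, abs_mul, Real.dist_eq, abs_sub_comm (b i)]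
  calc |u - v| * dist a b ≤ |u - v| * (2 * |a i - b i|) := by gcongr
    _ = _ := by push_cast; ring

theorem lintegral_crossings_of_subset_segment {A : Set Plane} (hA : MeasurableSet A)
    {a b : Plane} (h : A ⊆ segment ℝ a b) (i : Fin 2) :
    (crossings A i =ᵐ[volume] ((fun p : Plane => p i) '' A).indicator 1) ∧
    ∫⁻ t, crossings A i t = volume ((fun p : Plane => p i) '' A) := by
  have hae : crossings A i =ᵐ[volume] ((fun p : Plane => p i) '' A).indicator 1 := by
    filter_upwards [Measure.ae_ne volume (a i)] with t ht
    exact crossings_eq_indicator h i ht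
  refine ⟨hae, ?_⟩
  rw [lintegral_congr_ae hae, lintegral_indicator_one (measurableSet_image_coord hA h i)]

/-- The properties of the counting functions of a rectifiable plane set that follow from
Crofton's formula for the two coordinate directions. -/
structure HasCrossingBounds (A : Set Plane) : Prop where
  aemeasurable : ∀ i, AEMeasurable (crossings A i) volume
  ae_lt_top : ∀ i, ∀ᵐ t, crossings A i t < ∞
  lintegral_le : ∀ i, ∫⁻ t, crossings A i t ≤ Measure.hausdorffMeasure 1 A
  le_lintegral : Measure.hausdorffMeasure 1 A ≤ 2 * ∑ i, ∫⁻ t, crossings A i t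

theorem hasCrossingBounds_of_subset_segment {A : Set Plane} (hA : MeasurableSet A)
    {a b : Plane} (h : A ⊆ segment ℝ a b) : HasCrossingBounds A where
  aemeasurable i := by
    refine AEMeasurable.congr ?_ (lintegral_crossings_of_subset_segment hA h i).1.symm
    exact (measurable_one.indicator (measurableSet_image_coord hA h i)).aemeasurable
  ae_lt_top i := by
    filter_upwards [(lintegral_crossings_of_subset_segment hA h i).1] with t ht
    rw [ht]
    refine lt_of_le_of_lt (Set.indicator_le_self' (fun _ _ => zero_le) t) ?_
    simp
  lintegral_le i := by
    rw [(lintegral_crossings_of_subset_segment hA h i).2]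
    exact volume_image_coord_le A i
  le_lintegral := by
    obtain ⟨i, hi⟩ := exists_hausdorffMeasure_le_of_subset_segment h
    refine hi.trans ?_
    gcongr
    rw [← (lintegral_crossings_of_subset_segment hA h i).2]
    exact Finset.single_le_sum (f := fun i => ∫⁻ t, crossings A i t) (fun _ _ => zero_le)
      (Finset.mem_univ i)

theorem measurableSet_coord_eq (i : Fin 2) (t : ℝ) : MeasurableSet {p : Plane | p i = t} :=
  (isClosed_singleton.preimage (f := fun p : Plane => p i) (by fun_prop)).measurableSet

theorem HasCrossingBounds.union {A B : Set Plane} (hA : HasCrossingBounds A)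
    (hB : HasCrossingBounds B) (hd : Disjoint A B) (hBm : MeasurableSet B) :
    HasCrossingBounds (A ∪ B) := by
  have hadd : ∀ i, crossings (A ∪ B) i = crossings A i + crossings B i := by
    intro i
    funext t
    simp only [crossings, Pi.add_apply, Set.union_inter_distrib_right]
    exact measure_union (hd.mono Set.inter_subset_left Set.inter_subset_left)
      (hBm.inter (measurableSet_coord_eq i t))
  have hint : ∀ i, ∫⁻ t, crossings (A ∪ B) i t
      = (∫⁻ t, crossings A i t) + ∫⁻ t, crossings B i t := by
    intro i
    rw [hadd i]
    exact lintegral_add_left' (hA.aemeasurable i) _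
  refine ⟨fun i => ?_, fun i => ?_, fun i => ?_, ?_⟩
  · rw [hadd]; exact (hA.aemeasurable i).add (hB.aemeasurable i)
  · filter_upwards [hA.ae_lt_top i, hB.ae_lt_top i] with t h1 h2
    rw [hadd]
    exact ENNReal.add_lt_top.2 ⟨h1, h2⟩
  · rw [hint, measure_union hd hBm]
    exact add_le_add (hA.lintegral_le i) (hB.lintegral_le i)
  · simp_rw [hint]
    rw [measure_union hd hBm, Finset.sum_add_distrib, mul_add]
    exact add_le_add hA.le_lintegral hB.le_lintegral

theorem isClosed_segment (a b : Plane) : IsClosed (segment ℝ a b) := by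
  rw [segment_eq_image_lineMap]
  exact (isCompact_Icc.image AffineMap.lineMap_continuous).isClosed

/-- Cutting off one segment at a time leaves disjoint pieces, on which counts and lengths add, so
the constants do not depend on the number of segments. -/
theorem hasCrossingBounds_of_subset_biUnion (S : Finset (Plane × Plane)) :
    ∀ A : Set Plane, MeasurableSet A → A ⊆ (⋃ s ∈ S, segment ℝ s.1 s.2) →
      HasCrossingBounds A := by
  induction S using Finset.induction_on with
  | empty =>
    intro A hA h
    have h0 : A ⊆ segment ℝ (0 : Plane) 0 := h.trans (by simp)
    exact hasCrossingBounds_of_subset_segment hA h0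
  | insert s S _ ih =>
    intro A hA h
    have hs := (isClosed_segment s.1 s.2).measurableSet
    rw [← Set.inter_union_sdiff A (segment ℝ s.1 s.2)]
    refine (hasCrossingBounds_of_subset_segment (hA.inter hs) Set.inter_subset_right).union
      (ih _ (hA.diff hs) ?_) ?_ (hA.diff hs)
    · rintro p ⟨hp, hps⟩
      have := h hp
      rw [Finset.set_biUnion_insert] at this
      exact this.resolve_left hps
    · exact Set.disjoint_left.2 fun p hp hp' => hp'.2 hp.2

theorem IsSegmentUnion.hasCrossingBounds {A B : Set Plane} (hB : IsSegmentUnion B)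
    (hA : MeasurableSet A) (h : A ⊆ B) : HasCrossingBounds A := by
  obtain ⟨S, rfl⟩ := hB
  exact hasCrossingBounds_of_subset_biUnion S A hA h

/-! ### Crossings of ∂R \ ∂P against crossings of ∂P -/

/-- Rank x ∈ X by the number of points of Y below it. Three points of equal rank are impossible,
since a point of Y between the outer two raises the rank of the last; and there are only #Y + 1
ranks. -/
theorem card_le_of_separated {α : Type*} (X Y : Finset α) (g : α → ℝ) (hg : Set.InjOn g X)
    (h : ∀ x ∈ X, ∀ y ∈ X, ∀ z ∈ X, g x < g y → g y < g z → ∃ w ∈ Y, g x < g w ∧ g w < g z) :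
    X.card ≤ 2 * (Y.card + 1) := by
  classical
  have := Finset.card_le_mul_card_image_of_maps_to (s := X) (t := Finset.range (Y.card + 1))
    (f := fun x => (Y.filter fun w => g w < g x).card)
    (fun x _ => Finset.mem_range.2 (Nat.lt_succ_of_le (Finset.card_filter_le _ _))) 2 ?_
  · simpa using this
  intro n _
  by_contra! hcard
  set Z := X.filter fun x => (Y.filter fun w => g w < g x).card = n with hZ
  have hZX : ∀ x ∈ Z, x ∈ X := fun x hx => (Finset.mem_filter.1 hx).1
  have hne : Z.Nonempty := Finset.card_pos.1 (by omega)
  obtain ⟨x, hx, hmin⟩ := Z.exists_min_image g hne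
  obtain ⟨z, hz, hmax⟩ := Z.exists_max_image g hne
  have hpos : 0 < ((Z.erase x).erase z).card := by
    have h1 := Finset.pred_card_le_card_erase (s := Z) (a := x)
    have h2 := Finset.pred_card_le_card_erase (s := Z.erase x) (a := z)
    omega
  obtain ⟨y, hy⟩ := Finset.card_pos.1 hpos
  simp only [Finset.mem_erase] at hy
  obtain ⟨hyz, hyx, hyZ⟩ := hy
  have hxy : g x < g y := lt_of_le_of_ne (hmin y hyZ)
    fun e => hyx (hg (hZX y hyZ) (hZX x hx) e.symm)
  have hyz' : g y < g z := lt_of_le_of_ne (hmax y hyZ)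
    fun e => hyz (hg (hZX y hyZ) (hZX z hz) e)
  obtain ⟨w, hw, hxw, hwz⟩ := h x (hZX x hx) y (hZX y hyZ) z (hZX z hz) hxy hyz'
  have hlt : (Y.filter fun w => g w < g x).card < (Y.filter fun w => g w < g z).card := by
    refine Finset.card_lt_card (Finset.ssubset_iff_subset_ne.2 ⟨fun v hv => ?_, fun e => ?_⟩)
    · simp only [Finset.mem_filter] at hv ⊢
      exact ⟨hv.1, hv.2.trans (hxy.trans hyz')⟩
    · have : w ∈ Y.filter fun w => g w < g x := by
        rw [e]; simp [hw, hwz]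
      exact absurd (Finset.mem_filter.1 this).2 hxw.not_gt
  rw [(Finset.mem_filter.1 hx).2, (Finset.mem_filter.1 hz).2] at hlt
  exact lt_irrefl _ hlt

theorem ext_of_coord_eq {i j : Fin 2} (hij : i ≠ j) {p q : Plane} (hi : p i = q i)
    (hj : p j = q j) : p = q := by
  refine dist_le_zero.1 ((dist_le_abs_add_abs hij p q).trans ?_)
  simp [hi, hj]

theorem mem_openSegment_of_coord {i j : Fin 2} (hij : i ≠ j) {x y z : Plane} (hx : x i = y i)
    (hz : z i = y i) (hxy : x j < y j) (hyz : y j < z j) : y ∈ openSegment ℝ x z := by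
  rw [openSegment_eq_image_lineMap]
  have hpos : 0 < z j - x j := by linarith
  refine ⟨(y j - x j) / (z j - x j), ⟨by apply div_pos <;> linarith,
    by rw [div_lt_one hpos]; linarith⟩, ext_of_coord_eq hij ?_ ?_⟩
  · simp [AffineMap.lineMap_apply, hx, hz]
  · simp only [AffineMap.lineMap_apply, vsub_eq_sub, vadd_eq_add, PiLp.add_apply,
      PiLp.smul_apply, PiLp.sub_apply, smul_eq_mul]
    field_simp
    ring

theorem infinite_segment_of_ne {x z : Plane} (h : x ≠ z) : (segment ℝ x z).Infinite := by
  rw [segment_eq_image_lineMap]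
  exact (Set.Icc_infinite zero_lt_one).image (AffineMap.lineMap_injective ℝ h).injOn

theorem IsGeodesicallyConvexIn.crossings_le {P R K : Set Plane} (hP : IsClosed P)
    (hR : IsGeodesicallyConvexIn P R) (hK : Convex ℝ K) (hRK : closure R ⊆ K) (i : Fin 2) {t : ℝ}
    (hE : crossings (frontier R \ frontier P) i t < ∞)
    (hF : crossings (frontier P ∩ K) i t < ∞) :
    crossings (frontier R \ frontier P) i t ≤
      2 * crossings (frontier P ∩ K) i t
        + 2 * ((fun p : Plane => p i) '' K).indicator 1 t := by
  obtain ⟨j, hij⟩ : ∃ j : Fin 2, i ≠ j := ⟨i + 1, by fin_cases i <;> simp⟩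
  unfold crossings at *
  have hEf := Measure.count_apply_lt_top.1 hE
  have hFf := Measure.count_apply_lt_top.1 hF
  rcases Set.eq_empty_or_nonempty ((frontier R \ frontier P) ∩ {p : Plane | p i = t}) with h0 | h0
  · rw [h0]; simp
  have hmem : t ∈ (fun p : Plane => p i) '' K := by
    obtain ⟨p, hp, hpt⟩ := h0
    exact ⟨p, hRK hp.1.1, hpt⟩
  rw [Measure.count_apply_finite _ hEf, Measure.count_apply_finite _ hFf,
    Set.indicator_of_mem hmem, Pi.one_apply, ← mul_add]
  have key := card_le_of_separated hEf.toFinset hFf.toFinset (fun p : Plane => p j) ?_ ?_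
  · exact_mod_cast key
  · intro p hp q hq hpq
    simp only [Set.Finite.coe_toFinset] at hp hq
    exact ext_of_coord_eq hij (hp.2.trans hq.2.symm) hpq
  · simp only [Set.Finite.mem_toFinset]
    intro x hx y hy z hz hxy hyz
    have hyo := mem_openSegment_of_coord hij (hx.2.trans hy.2.symm) (hz.2.trans hy.2.symm) hxy hyz
    have hxz : x i = z i := hx.2.trans hz.2.symm
    have hne : x ≠ z := by rintro rfl; exact absurd (hxy.trans hyz) (lt_irrefl _)
    by_cases hd : Disjoint (segment ℝ x z) (frontier P)
    -- Without a point of ∂P in between, the whole segment would lie in ∂R \ ∂P and on the line,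
    -- against finiteness.
    · refine absurd (Set.Finite.subset hEf ?_) (infinite_segment_of_ne hne)
      refine fun w hw => ⟨⟨?_, Set.disjoint_left.1 hd hw⟩, ?_⟩
      · exact hR.segment_subset_frontier hP hx.1.1 hy.1.1 hz.1.1 hyo hd hw
      · exact (coord_eq_of_mem_segment hxz hw).trans hx.2
    · obtain ⟨w, hw, hwP⟩ := Set.not_disjoint_iff.1 hd
      have hwx : w ≠ x := fun e => hx.1.2 (e ▸ hwP)
      have hwz : w ≠ z := fun e => hz.1.2 (e ▸ hwP)
      refine ⟨w, ⟨⟨hwP, hK.segment_subset (hRK hx.1.1.1) (hRK hz.1.1.1) hw⟩,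
        (coord_eq_of_mem_segment hxz hw).trans hx.2⟩, ?_⟩
      have hwo : w ∈ openSegment ℝ x z := by
        rw [← insert_endpoints_openSegment] at hw
        rcases hw with h | h | h
        exacts [absurd h hwx, absurd h hwz, h]
      rw [openSegment_eq_image_lineMap] at hwo
      obtain ⟨u, ⟨hu0, hu1⟩, rfl⟩ := hwo
      have hlt := hxy.trans hyz
      simp only [AffineMap.lineMap_apply, vsub_eq_sub, vadd_eq_add, PiLp.add_apply,
        PiLp.smul_apply, PiLp.sub_apply, smul_eq_mul]
      constructor <;> nlinarith

theorem volume_image_coord_le_ediam (K : Set Plane) (i : Fin 2) :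
    volume ((fun p : Plane => p i) '' K) ≤ Metric.ediam K := by
  refine (Real.volume_le_diam _).trans ?_
  have hL : LipschitzWith 1 (fun p : Plane => p i) :=
    LipschitzWith.of_dist_le_mul fun p q => by
      simpa [Real.dist_eq] using abs_coord_sub_le_dist p q i
  simpa using hL.ediam_image_le K

theorem IsGeodesicallyConvexIn.perimeter_le {P R K : Set Plane} (hP : IsPolygonalDomain P)
    (hR : IsGeodesicallyConvexIn P R) (hRP : IsSegmentUnion (closure (frontier R \ frontier P)))
    (hK : Convex ℝ K) (hKc : IsCompact K) (hRK : closure R ⊆ K) :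
    perimeter R ≤ 9 * Measure.hausdorffMeasure 1 (frontier P ∩ K) + 8 * Metric.ediam K := by
  have hEm : MeasurableSet (frontier R \ frontier P) :=
    isClosed_frontier.measurableSet.diff isClosed_frontier.measurableSet
  have hFm : MeasurableSet (frontier P ∩ K) :=
    isClosed_frontier.measurableSet.inter hKc.isClosed.measurableSet
  have hE := hRP.hasCrossingBounds hEm subset_closure
  have hF := hP.boundary.hasCrossingBounds hFm Set.inter_subset_left
  have hline : ∀ i, ∫⁻ t, crossings (frontier R \ frontier P) i t ≤
      2 * Measure.hausdorffMeasure 1 (frontier P ∩ K) + 2 * Metric.ediam K := by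
    intro i
    have hIm : MeasurableSet ((fun p : Plane => p i) '' K) :=
      (hKc.image (by fun_prop)).measurableSet
    calc ∫⁻ t, crossings (frontier R \ frontier P) i t
        ≤ ∫⁻ t, (2 * crossings (frontier P ∩ K) i t
          + 2 * ((fun p : Plane => p i) '' K).indicator 1 t) := by
          refine lintegral_mono_ae ?_
          filter_upwards [hE.ae_lt_top i, hF.ae_lt_top i] with t h1 h2
          exact hR.crossings_le hP.isCompact.isClosed hK hRK i h1 h2
      _ = 2 * (∫⁻ t, crossings (frontier P ∩ K) i t)
          + 2 * volume ((fun p : Plane => p i) '' K) := by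
          rw [lintegral_add_left' ((hF.aemeasurable i).const_mul 2),
            lintegral_const_mul'' _ (hF.aemeasurable i),
            lintegral_const_mul _ (measurable_one.indicator hIm), lintegral_indicator_one hIm]
      _ ≤ _ := by
          gcongr
          · exact hF.lintegral_le i
          · exact volume_image_coord_le_ediam K i
  have hE1 : Measure.hausdorffMeasure 1 (frontier R \ frontier P) ≤
      8 * Measure.hausdorffMeasure 1 (frontier P ∩ K) + 8 * Metric.ediam K := by
    refine hE.le_lintegral.trans ?_
    rw [Fin.sum_univ_two]
    -- Factor 8 = 2 (length from counts) · 2 (directions) · 2 (crossings per gap).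
    refine (mul_le_mul_right (add_le_add (hline 0) (hline 1)) 2).trans (le_of_eq ?_)
    ring
  have hsub : frontier R ⊆ (frontier R \ frontier P) ∪ (frontier P ∩ K) := by
    intro p hp
    by_cases h : p ∈ frontier P
    · exact Or.inr ⟨h, hRK hp.1⟩
    · exact Or.inl ⟨hp, h⟩
  calc perimeter R ≤ _ := measure_mono hsub
    _ ≤ _ := measure_union_le _ _
    _ ≤ _ := add_le_add_left hE1 _
    _ = _ := by ring

/-! ### Large discs in fat triangles -/

/-- The signed area of the parallelogram spanned by two plane vectors. -/
def cross (u v : Plane) : ℝ := u 0 * v 1 - u 1 * v 0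

theorem norm_sq_eq_coord (u : Plane) : ‖u‖ ^ 2 = u 0 ^ 2 + u 1 ^ 2 := by
  rw [EuclideanSpace.norm_sq_eq, Fin.sum_univ_two, Real.norm_eq_abs, Real.norm_eq_abs, sq_abs,
    sq_abs]

theorem abs_cross_le (u v : Plane) : |cross u v| ≤ ‖u‖ * ‖v‖ := by
  refine abs_le_of_sq_le_sq ?_ (by positivity)
  rw [mul_pow, norm_sq_eq_coord, norm_sq_eq_coord, cross]
  nlinarith [sq_nonneg (u 0 * v 0 + u 1 * v 1)]

theorem abs_cross_eq_sin (u v : Plane) :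
    |cross u v| = Real.sin (InnerProductGeometry.angle u v) * (‖u‖ * ‖v‖) := by
  rw [InnerProductGeometry.sin_angle_mul_norm_mul_norm, ← Real.sqrt_sq_eq_abs]
  congr 1
  simp only [PiLp.inner_apply, Fin.sum_univ_two, RCLike.inner_apply, conj_trivial, cross]
  ring

theorem sin_mul_le_abs_cross {α : ℝ} (h0 : 0 ≤ α) {u v : Plane}
    (h1 : α ≤ InnerProductGeometry.angle u v) (h2 : InnerProductGeometry.angle u v ≤ Real.pi - α) :
    Real.sin α * (‖u‖ * ‖v‖) ≤ |cross u v| := by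
  rw [abs_cross_eq_sin]
  gcongr
  rcases le_total (InnerProductGeometry.angle u v) (Real.pi / 2) with h | h
  · exact Real.sin_le_sin_of_le_of_le_pi_div_two (by linarith [Real.pi_pos]) h h1
  · rw [← Real.sin_pi_sub (InnerProductGeometry.angle u v)]
    exact Real.sin_le_sin_of_le_of_le_pi_div_two (by linarith [Real.pi_pos]) (by linarith)
      (by linarith)

theorem IsFatTriangle.ne {α : ℝ} {p a b : Plane} (h : IsFatTriangle α p a b) :
    p ≠ a ∧ p ≠ b ∧ a ≠ b := by
  have hi := h.1.injective
  refine ⟨fun e => ?_, fun e => ?_, fun e => ?_⟩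
  · exact absurd (@hi 0 1 (by simpa using e)) (by decide)
  · exact absurd (@hi 0 2 (by simpa using e)) (by decide)
  · exact absurd (@hi 1 2 (by simpa using e)) (by decide)

theorem IsFatTriangle.angle_sum {α : ℝ} {p a b : Plane} (h : IsFatTriangle α p a b) :
    ∠ a p b + ∠ p a b + ∠ p b a = Real.pi := by
  have := EuclideanGeometry.angle_add_angle_add_angle_eq_pi b h.ne.1
  rw [EuclideanGeometry.angle_comm b a p] at this
  linarith

theorem IsFatTriangle.le_pi_div_three {α : ℝ} {p a b : Plane} (h : IsFatTriangle α p a b) :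
    α ≤ Real.pi / 3 := by
  linarith [h.angle_sum, h.2.1, h.2.2.1, h.2.2.2]

theorem mem_convexHull_triple_of_eq {p a b q : Plane} {x y : ℝ} (hx : 0 ≤ x) (hy : 0 ≤ y)
    (hxy : x + y ≤ 1) (hq : q = p + x • (a - p) + y • (b - p)) :
    q ∈ convexHull ℝ {p, a, b} := by
  have h := (convex_convexHull ℝ {p, a, b}).sum_mem (t := Finset.univ)
    (w := ![1 - x - y, x, y]) (z := ![p, a, b])
    (by intro i _; fin_cases i <;> simp <;> linarith)
    (by simp [Fin.sum_univ_three]; ring)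
    (by intro i _; apply subset_convexHull; fin_cases i <;> simp)
  convert h using 1
  rw [hq]
  simp only [Fin.sum_univ_three, Matrix.cons_val]
  module

/-- An `α`-fat triangle contains a disc that is large compared to the distance between its centre
and a vertex, and compared to the shortest side. -/
theorem IsFatTriangle.exists_ball_subset {α s : ℝ} (hα : 0 < α) {p a b : Plane}
    (h : IsFatTriangle α p a b) (hpa : s ≤ dist p a) :
    ∃ (w : Plane) (r : ℝ), 0 < r ∧ Metric.ball (p + w) r ⊆ convexHull ℝ {p, a, b} ∧
      Real.sin α / 6 * ‖w‖ ≤ r ∧ Real.sin α / 6 * s ≤ r := by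
  obtain ⟨hne1, hne2, hne3⟩ := h.ne
  have hsum := h.angle_sum
  obtain ⟨-, h1, h2, h3⟩ := h
  have hsin : 0 < Real.sin α := Real.sin_pos_of_pos_of_lt_pi hα (by linarith)
  set A := a - p with hA
  set B := b - p with hB
  set D := cross A B with hD
  have hX : 0 < ‖A‖ := norm_pos_iff.2 (sub_ne_zero.2 hne1.symm)
  have e1 : Real.sin α * (‖A‖ * ‖B‖) ≤ |D| :=
    sin_mul_le_abs_cross hα.le (u := A) (v := B) h1 (by change ∠ a p b ≤ _; linarith)
  have e2 : Real.sin α * (‖A‖ * ‖B - A‖) ≤ |D| := by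
    have := sin_mul_le_abs_cross hα.le (u := p - a) (v := b - a) h2
      (by change ∠ p a b ≤ _; linarith)
    have hc : cross (p - a) (b - a) = -D := by
      simp [hD, cross, hA, hB]; ring
    rw [hc, abs_neg, norm_sub_rev p a] at this
    rwa [hA, hB, sub_sub_sub_cancel_right]
  have e3 : Real.sin α * (‖B‖ * ‖B - A‖) ≤ |D| := by
    have := sin_mul_le_abs_cross hα.le (u := p - b) (v := a - b) h3
      (by change ∠ p b a ≤ _; linarith)
    have hc : cross (p - b) (a - b) = D := by
      simp [hD, cross, hA, hB]; ring
    rw [hc, norm_sub_rev p b, norm_sub_rev a b] at this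
    rwa [hA, hB, sub_sub_sub_cancel_right]
  -- ℓ is the longest side. The second longest is at least ℓ/2 by the triangle inequality, and the
  -- angle between these two gives the area bound.
  obtain ⟨ℓ, hℓA, hℓB, hℓC, hℓD⟩ : ∃ ℓ, ‖A‖ ≤ ℓ ∧ ‖B‖ ≤ ℓ ∧ ‖B - A‖ ≤ ℓ ∧
      Real.sin α * ℓ ^ 2 ≤ 2 * |D| := by
    have t1 : ‖A‖ ≤ ‖B‖ + ‖B - A‖ := by
      calc ‖A‖ = ‖B - (B - A)‖ := by rw [sub_sub_cancel]
        _ ≤ _ := norm_sub_le _ _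
    have t2 : ‖B‖ ≤ ‖A‖ + ‖B - A‖ := by
      calc ‖B‖ = ‖A + (B - A)‖ := by rw [add_sub_cancel]
        _ ≤ _ := norm_add_le _ _
    have t3 : ‖B - A‖ ≤ ‖A‖ + ‖B‖ := by
      rw [add_comm]; exact norm_sub_le _ _
    have n1 := norm_nonneg A
    have n2 := norm_nonneg B
    have n3 := norm_nonneg (B - A)
    rcases le_total ‖A‖ ‖B‖ with g1 | g1 <;> rcases le_total ‖B‖ ‖B - A‖ with g2 | g2 <;>
      rcases le_total ‖A‖ ‖B - A‖ with g3 | g3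
    · exact ⟨‖B - A‖, g3, g2, le_rfl, by nlinarith [mul_nonneg hsin.le n3]⟩
    · exact ⟨‖B - A‖, by linarith, g2, le_rfl, by nlinarith [mul_nonneg hsin.le n3]⟩
    · exact ⟨‖B‖, g1, le_rfl, g2, by nlinarith [mul_nonneg hsin.le n2]⟩
    · exact ⟨‖B‖, g1, le_rfl, g2, by nlinarith [mul_nonneg hsin.le n2]⟩
    · exact ⟨‖B - A‖, g3, g2, le_rfl, by nlinarith [mul_nonneg hsin.le n3]⟩
    · exact ⟨‖A‖, le_rfl, g1, g3, by nlinarith [mul_nonneg hsin.le n1]⟩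
    · exact ⟨‖A‖, le_rfl, g1, by linarith, by nlinarith [mul_nonneg hsin.le n1]⟩
    · exact ⟨‖A‖, le_rfl, g1, g3, by nlinarith [mul_nonneg hsin.le n1]⟩
  have hℓ : 0 < ℓ := hX.trans_le hℓA
  have hDpos : 0 < |D| := by nlinarith [mul_pos hsin (pow_pos hℓ 2)]
  have hD0 : D ≠ 0 := abs_pos.1 hDpos
  have hr : Real.sin α / 6 * ℓ ≤ |D| / (3 * ℓ) := by
    rw [le_div_iff₀ (by positivity)]; nlinarith
  -- The centre is the centroid, whose distance to a side is a third of the height, that is |D| / (3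
  -- · side). Below, a displacement v within this radius changes each barycentric coordinate by at
  -- most 1/3.
  refine ⟨(1 / 3 : ℝ) • A + (1 / 3 : ℝ) • B, |D| / (3 * ℓ), by positivity, ?_, ?_, ?_⟩
  · intro q hq
    set v := q - (p + ((1 / 3 : ℝ) • A + (1 / 3 : ℝ) • B)) with hv
    have hvr : ‖v‖ < |D| / (3 * ℓ) := by rwa [← dist_eq_norm]
    have hbd : ∀ u : Plane, ‖u‖ ≤ ℓ → |cross v u / D| ≤ 1 / 3 := by
      intro u hu
      rw [abs_div, div_le_iff₀ hDpos]
      calc |cross v u| ≤ ‖v‖ * ‖u‖ := abs_cross_le _ _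
        _ ≤ |D| / (3 * ℓ) * ℓ := by gcongr
        _ = 1 / 3 * |D| := by field_simp
    have b1 := abs_le.1 (hbd B hℓB)
    have b2 := abs_le.1 (hbd A hℓA)
    have b3 := abs_le.1 (hbd (B - A) hℓC)
    have hsub : cross v (B - A) / D = cross v B / D - cross v A / D := by
      rw [← sub_div]; congr 1; simp [cross]; ring
    rw [hsub] at b3
    refine mem_convexHull_triple_of_eq (x := 1 / 3 + cross v B / D)
      (y := 1 / 3 - cross v A / D) (by linarith) (by linarith) (by linarith) ?_
    -- Cramer's rule.
    have hvc : v = (cross v B / D) • A - (cross v A / D) • B := by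
      ext i
      fin_cases i
      · simp only [Fin.zero_eta, PiLp.sub_apply, PiLp.smul_apply, smul_eq_mul]
        rw [div_mul_eq_mul_div, div_mul_eq_mul_div, ← sub_div, eq_div_iff hD0]
        simp only [hD, cross]; ring
      · simp only [Fin.mk_one, PiLp.sub_apply, PiLp.smul_apply, smul_eq_mul]
        rw [div_mul_eq_mul_div, div_mul_eq_mul_div, ← sub_div, eq_div_iff hD0]
        simp only [hD, cross]; ring
    have hq' : q = p + ((1 / 3 : ℝ) • A + (1 / 3 : ℝ) • B) + v := by rw [hv]; abel
    rw [hq']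
    nth_rewrite 1 [hvc]
    rw [← hA, ← hB]
    module
  · refine le_trans ?_ hr
    gcongr
    calc ‖(1 / 3 : ℝ) • A + (1 / 3 : ℝ) • B‖ ≤ 1 / 3 * ‖A‖ + 1 / 3 * ‖B‖ := by
          refine (norm_add_le _ _).trans (le_of_eq ?_)
          rw [norm_smul, norm_smul, Real.norm_of_nonneg (by norm_num)]
      _ ≤ ℓ := by linarith
  · refine le_trans ?_ hr
    gcongr
    refine hpa.trans ?_
    rwa [dist_comm, dist_eq_norm]

/-! ### Empty cones at boundary points -/

/-- The homothety with centre p and ratio u maps the disc into S, by convexity. -/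
theorem mem_interior_of_ball_subset {S P : Set Plane} (hS : Convex ℝ S) (hSP : S ⊆ P)
    {p w q : Plane} {r u : ℝ} (hp : p ∈ S) (hball : Metric.ball (p + w) r ⊆ S) (hu0 : 0 < u)
    (hu1 : u ≤ 1) (hq : ‖q - p - u • w‖ < u * r) : q ∈ interior P := by
  refine mem_interior.2 ⟨Metric.ball (p + u • w) (u * r), fun z hz => hSP ?_, Metric.isOpen_ball,
    by rwa [Metric.mem_ball, dist_eq_norm, ← sub_sub]⟩
  have hz' : p + u⁻¹ • (z - p) ∈ S := by
    apply hball
    rw [Metric.mem_ball, dist_eq_norm] at hz ⊢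
    have e : p + u⁻¹ • (z - p) - (p + w) = u⁻¹ • (z - (p + u • w)) := by
      rw [← sub_sub z, smul_sub u⁻¹ (z - p), smul_smul, inv_mul_cancel₀ hu0.ne', one_smul]
      abel
    rw [e, norm_smul, norm_inv, Real.norm_of_nonneg hu0.le, inv_mul_lt_iff₀ hu0]
    exact hz
  have := hS.add_smul_sub_mem hp hz' ⟨hu0.le, hu1⟩
  rwa [add_sub_cancel_left, smul_smul, mul_inv_cancel₀ hu0.ne', one_smul, add_sub_cancel] at this

/-- Along directions whose slope is close to `w j / w i`, the set `P` contains a neighbourhood of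
every point of the cone with apex `p`; so boundary points stay away from that cone. -/
theorem cone_bound {S P : Set Plane} (hS : Convex ℝ S) (hSP : S ⊆ P)
    {p w q : Plane} {r κ σ : ℝ} {i j : Fin 2} (hij : i ≠ j) (hp : p ∈ S)
    (hball : Metric.ball (p + w) r ⊆ S) (hr : κ * |w i| ≤ r)
    (hσ : |w j / w i - σ| ≤ κ / 2) (hq : q ∉ interior P) (hpos : 0 < w i * (q i - p i))
    (hle : |q i - p i| ≤ |w i|) :
    κ / 2 * |q i - p i| ≤ |(q j - p j) - σ * (q i - p i)| := by
  by_contra! hlt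
  have hw : w i ≠ 0 := fun e => by simp [e] at hpos
  have hu0 : 0 < (q i - p i) / w i := by
    rw [← mul_pos_iff_of_pos_right (pow_pos (abs_pos.2 hw) 2), sq_abs]
    calc 0 < w i * (q i - p i) := hpos
      _ = _ := by field_simp
  have hu : |q i - p i| = (q i - p i) / w i * |w i| := by
    rw [← abs_of_pos hu0, ← abs_mul, div_mul_cancel₀ _ hw]
  have hu1 : (q i - p i) / w i ≤ 1 := by
    have := abs_pos.2 hw
    rw [hu] at hle
    nlinarith
  set u := (q i - p i) / w i with hudef
  refine hq (mem_interior_of_ball_subset hS hSP hp hball hu0 hu1 ?_)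
  have hui : q i - p i = u * w i := by rw [hudef, div_mul_cancel₀ _ hw]
  have hd := dist_le_abs_add_abs hij (q - p) (u • w)
  rw [dist_eq_norm] at hd
  simp only [PiLp.sub_apply, PiLp.smul_apply, smul_eq_mul] at hd
  rw [hui, sub_self, abs_zero, zero_add] at hd
  -- The opening κ is spent in two halves: one for the deviation of q from slope σ, one for the
  -- error in the slope itself.
  have hsplit : q j - p j - u * w j
      = ((q j - p j) - σ * (q i - p i)) - (q i - p i) * (w j / w i - σ) := by
    rw [hui]; field_simp; ring
  rw [hsplit] at hd
  have h2 : |(q i - p i) * (w j / w i - σ)| ≤ |q i - p i| * (κ / 2) := by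
    rw [abs_mul]; gcongr
  calc ‖q - p - u • w‖ ≤ _ := hd
    _ ≤ _ := abs_sub _ _
    _ < κ / 2 * |q i - p i| + |q i - p i| * (κ / 2) := add_lt_add_of_lt_of_le hlt h2
    _ = u * (κ * |w i|) := by rw [hu]; ring
    _ ≤ u * r := by gcongr

/-- Every point `p` of `B` is the apex of a truncated cone, opening in the direction of a
coordinate axis sheared by some slope, that contains no other point of `B`. -/
def HasEmptyCones (κ h : ℝ) (B : Set Plane) : Prop :=
  ∀ p ∈ B, ∃ (i : Fin 2) (ε : Bool) (σ : ℝ), |σ| ≤ 1 ∧ ∀ q ∈ B, ∀ τ : ℝ, |σ - τ| ≤ κ / 2 →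
    0 < (if ε then 1 else -1) * (q i - p i) → |q i - p i| ≤ h →
      κ / 2 * |q i - p i| ≤ |(q (i + 1) - p (i + 1)) - τ * (q i - p i)|

theorem exists_coord_abs_ge (w : Plane) : ∃ i : Fin 2, |w (i + 1)| ≤ |w i| ∧ ‖w‖ ≤ 2 * |w i| := by
  have h := dist_le_abs_add_abs (i := 0) (j := 1) (by decide) w 0
  simp only [dist_zero_right, PiLp.zero_apply, sub_zero] at h
  rcases le_total |w 0| |w 1| with h' | h'
  · exact ⟨1, h', by linarith⟩
  · exact ⟨0, h', by linarith⟩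

theorem IsCovered.hasEmptyCones {α β : ℝ} (hα : 0 < α) {P : Set Plane} (h : IsCovered α β P) :
    HasEmptyCones (Real.sin α / 6) (Real.sin α / 6 * (β * Metric.diam P) / 2) (frontier P) := by
  intro p hp
  obtain ⟨a, b, hT, hTP, hs, -, -⟩ := h p hp
  obtain ⟨w, r, hr, hball, hκ, hκs⟩ := hT.exists_ball_subset hα hs
  have hpS : p ∈ convexHull ℝ {p, a, b} := subset_convexHull ℝ _ (by simp)
  -- Otherwise the disc would contain p itself. This yields the cone height: κβ·diam P / 2 ≤ r/2 ≤
  -- ‖w‖/2 ≤ |w i|.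
  have hrw : r ≤ ‖w‖ := by
    by_contra! hlt
    refine hp.2 (mem_interior.2 ⟨_, hball.trans hTP, Metric.isOpen_ball, ?_⟩)
    rwa [Metric.mem_ball, dist_eq_norm, sub_add_cancel_left, norm_neg]
  obtain ⟨i, hi1, hi2⟩ := exists_coord_abs_ge w
  have hij : i ≠ i + 1 := by fin_cases i <;> simp
  have hsin : 0 ≤ Real.sin α := Real.sin_nonneg_of_nonneg_of_le_pi hα.le
    (by linarith [hT.le_pi_div_three, Real.pi_pos])
  have hwi : 0 < |w i| := by linarith
  refine ⟨i, decide (0 < w i), w (i + 1) / w i, ?_, fun q hq τ hτ hpos hle => ?_⟩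
  · rw [abs_div]; exact div_le_one_of_le₀ hi1 hwi.le
  · refine cone_bound (convex_convexHull ℝ _) hTP hij hpS hball ?_ hτ hq.2 ?_ (by linarith)
    · refine le_trans ?_ hκ
      gcongr
      exact PiLp.norm_apply_le w i
    · by_cases hw : 0 < w i
      · simp only [hw, decide_true, if_true, one_mul] at hpos
        exact mul_pos hw hpos
      · simp only [hw, decide_false, Bool.false_eq_true, if_false] at hpos
        have : w i < 0 := lt_of_le_of_ne (not_lt.1 hw) (abs_pos.1 hwi)
        nlinarith

/-! ### Length of a set with empty cones -/

theorem floor_mem_Icc_ceil {x y : ℝ} (h : |x| ≤ y) : ⌊x⌋ ∈ Finset.Icc (-⌈y⌉) ⌈y⌉ := by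
  rw [Finset.mem_Icc]
  obtain ⟨h1, h2⟩ := abs_le.1 h
  constructor
  · rw [Int.le_floor]; push_cast; linarith [Int.le_ceil y]
  · exact_mod_cast (Int.floor_le x).trans (h2.trans (Int.le_ceil y))

theorem card_Icc_neg_ceil_le {y : ℝ} (hy : 0 ≤ y) :
    ((Finset.Icc (-⌈y⌉) ⌈y⌉).card : ℝ) ≤ 2 * y + 3 := by
  have hc : 0 ≤ ⌈y⌉ := Int.ceil_nonneg hy
  have : ((Finset.Icc (-⌈y⌉) ⌈y⌉).card : ℤ) = 2 * ⌈y⌉ + 1 := by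
    rw [Int.card_Icc, Int.toNat_of_nonneg (by omega)]; ring
  have h2 : ((Finset.Icc (-⌈y⌉) ⌈y⌉).card : ℝ) = 2 * (⌈y⌉ : ℝ) + 1 := by exact_mod_cast this
  rw [h2]
  linarith [Int.ceil_lt_add_one y]

/-- The length of a piece of a set with empty cones on which all the cones point in roughly the
same direction, and which lies in a thin slab. -/
theorem hausdorffMeasure_le_of_same_cone {κ d : ℝ} (hκ0 : 0 < κ) (hκ1 : κ ≤ 1)
    {A : Set Plane} {i : Fin 2} {τ : ℝ} (hτ : |τ| ≤ 2)
    (hd : ∀ p ∈ A, ∀ q ∈ A, dist p q ≤ d)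
    (hA : ∀ p ∈ A, ∀ q ∈ A,
      κ / 2 * |p i - q i| ≤ |(p (i + 1) - q (i + 1)) - τ * (p i - q i)|) :
    Measure.hausdorffMeasure 1 A ≤ ENNReal.ofReal (21 * d / κ) := by
  have hij : i ≠ i + 1 := by fin_cases i <;> simp
  set f : Plane → ℝ := fun p => p (i + 1) - τ * p i with hf
  have hff : ∀ p q : Plane, (p (i + 1) - q (i + 1)) - τ * (p i - q i) = f p - f q := by
    intro p q; simp only [hf]; ring
  -- The cone condition bounds the i-th coordinate difference by (2/κ)|f p - f q|, so the distance
  -- is at most (1 + 6/κ)|f p - f q|, and 1 ≤ 1/κ.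
  have hM : ∀ p ∈ A, ∀ q ∈ A, dist p q ≤ (7 / κ).toNNReal * |f p - f q| := by
    intro p hp q hq
    rw [Real.coe_toNNReal _ (by positivity), div_mul_eq_mul_div, le_div_iff₀ hκ0]
    have h1 := hA p hp q hq
    have h2 := dist_le_abs_add_abs hij p q
    have h3 : |p (i + 1) - q (i + 1)| ≤ |f p - f q| + 2 * |p i - q i| := by
      calc |p (i + 1) - q (i + 1)| = |(f p - f q) + τ * (p i - q i)| := by
            rw [← hff, sub_add_cancel]
        _ ≤ |f p - f q| + |τ| * |p i - q i| := by rw [← abs_mul]; exact abs_add_le _ _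
        _ ≤ _ := by gcongr
    rw [hff] at h1
    have h4 : dist p q ≤ |f p - f q| + 3 * |p i - q i| := by linarith
    nlinarith [abs_nonneg (f p - f q), abs_nonneg (p i - q i)]
  refine (hausdorffMeasure_one_le_mul_volume_image hM).trans ?_
  have hvol : volume (f '' A) ≤ ENNReal.ofReal (3 * d) := by
    refine (Real.volume_le_diam _).trans (Metric.ediam_le ?_)
    rintro _ ⟨p, hp, rfl⟩ _ ⟨q, hq, rfl⟩
    rw [edist_dist]
    refine ENNReal.ofReal_le_ofReal ?_
    rw [Real.dist_eq, ← hff]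
    calc |(p (i + 1) - q (i + 1)) - τ * (p i - q i)|
        ≤ |p (i + 1) - q (i + 1)| + |τ| * |p i - q i| := by
          rw [← abs_mul]; exact abs_sub _ _
      _ ≤ dist p q + 2 * dist p q := by
          gcongr
          · exact abs_coord_sub_le_dist p q _
          · exact abs_coord_sub_le_dist p q _
      _ ≤ 3 * d := by linarith [hd p hp q hq]
  calc ((7 / κ).toNNReal : ℝ≥0∞) * volume (f '' A)
      ≤ ENNReal.ofReal (7 / κ) * ENNReal.ofReal (3 * d) := by gcongr; rfl
    _ = ENNReal.ofReal (21 * d / κ) := by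
        rw [← ENNReal.ofReal_mul (by positivity)]; congr 1; ring

-- Pigeonhole on axis, sign, slope rounded down to a multiple of κ/2, and slab of width h. The slope
-- tolerance κ/2 in `HasEmptyCones` lets all points of a class share one slope.
set_option maxHeartbeats 1000000 in
theorem HasEmptyCones.hausdorffMeasure_le {κ h d : ℝ} {B : Set Plane} (hB : HasEmptyCones κ h B)
    (hκ0 : 0 < κ) (hκ1 : κ ≤ 1) (hh : 0 < h) (hd0 : 0 ≤ d) {K : Set Plane}
    (hd : ∀ p ∈ K, ∀ q ∈ K, dist p q ≤ d) :
    Measure.hausdorffMeasure 1 (B ∩ K) ≤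
      ENNReal.ofReal (4 * (4 / κ + 3) * (2 * (d / h) + 3) * (21 * d / κ)) := by
  classical
  rcases K.eq_empty_or_nonempty with rfl | ⟨o, ho⟩
  · simp
  choose! I ε σ hσ hcone using hB
  set J : Finset (Fin 2 × Bool × ℤ × ℤ) := Finset.univ ×ˢ Finset.univ ×ˢ
    Finset.Icc (-⌈2 / κ⌉) ⌈2 / κ⌉ ×ˢ Finset.Icc (-⌈d / h⌉) ⌈d / h⌉ with hJ
  set A : Fin 2 × Bool × ℤ × ℤ → Set Plane := fun c => {p | p ∈ B ∩ K ∧ I p = c.1 ∧ ε p = c.2.1 ∧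
    ⌊σ p * (2 / κ)⌋ = c.2.2.1 ∧ ⌊(p (I p) - o (I p)) / h⌋ = c.2.2.2} with hAdef
  have hcover : B ∩ K ⊆ ⋃ c ∈ J, A c := by
    intro p hp
    refine Set.mem_iUnion₂.2 ⟨(I p, ε p, ⌊σ p * (2 / κ)⌋, ⌊(p (I p) - o (I p)) / h⌋), ?_,
      hp, rfl, rfl, rfl, rfl⟩
    simp only [hJ, Finset.mem_product, Finset.mem_univ, true_and]
    refine ⟨floor_mem_Icc_ceil ?_, floor_mem_Icc_ceil ?_⟩
    · have h0 : 0 < 2 / κ := by positivity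
      rw [abs_mul, abs_of_pos h0]
      exact mul_le_of_le_one_left h0.le (hσ p hp.1)
    · rw [abs_div, abs_of_pos hh]
      gcongr
      exact (abs_coord_sub_le_dist p o _).trans (hd p hp.2 o ho)
  have hpiece : ∀ c ∈ J, Measure.hausdorffMeasure 1 (A c) ≤ ENNReal.ofReal (21 * d / κ) := by
    rintro ⟨i, e, k, l⟩ -
    rcases (A (i, e, k, l)).eq_empty_or_nonempty with h0 | ⟨p₀, hp₀⟩
    · rw [h0]; simp
    have hslope : ∀ p ∈ A (i, e, k, l), |σ p - k * (κ / 2)| ≤ κ / 2 := by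
      rintro p ⟨-, -, -, hk, -⟩
      have h1 := Int.floor_le (σ p * (2 / κ))
      have h2 := Int.lt_floor_add_one (σ p * (2 / κ))
      simp only at hk
      rw [hk] at h1 h2
      have e1 : σ p = σ p * (2 / κ) * (κ / 2) := by field_simp
      rw [abs_le]
      constructor
      · rw [e1]; nlinarith
      · rw [e1]; nlinarith
    refine hausdorffMeasure_le_of_same_cone (i := i) (τ := k * (κ / 2)) hκ0 hκ1 ?_
      (fun p hp q hq => hd p hp.1.2 q hq.1.2) ?_
    · have h1 := abs_le.1 (hslope p₀ hp₀)
      have h2 := abs_le.1 (hσ p₀ hp₀.1.1)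
      rw [abs_le]
      constructor <;> linarith
    · have main : ∀ p ∈ A (i, e, k, l), ∀ q ∈ A (i, e, k, l),
          0 < (if e then 1 else -1) * (q i - p i) →
          κ / 2 * |q i - p i| ≤ |(q (i + 1) - p (i + 1)) - k * (κ / 2) * (q i - p i)| := by
        intro p hp q hq hpos
        have hsl := hslope p hp
        obtain ⟨⟨hpB, -⟩, hpi, hpe, -, hpl⟩ := hp
        obtain ⟨⟨hqB, -⟩, hqi, -, -, hql⟩ := hq
        simp only at hpi hpe hpl hqi hql
        have := hcone p hpB q hqB (k * (κ / 2)) hsl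
        rw [hpi, hpe] at this
        refine this hpos ?_
        rw [hpi] at hpl
        rw [hqi] at hql
        have hfl := Int.abs_sub_lt_one_of_floor_eq_floor (hql.trans hpl.symm)
        rw [← sub_div, abs_div, abs_of_pos hh, div_lt_one hh] at hfl
        simpa using hfl.le
      intro p hp q hq
      -- Of two points in a class, one lies on the forward side of the other, whose cone then gives
      -- the inequality.
      rcases lt_trichotomy 0 ((if e then (1 : ℝ) else -1) * (p i - q i)) with hpos | hzero | hneg
      · exact main q hq p hp hpos
      · have : p i - q i = 0 := by
          rcases mul_eq_zero.1 hzero.symm with h0 | h0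
          · split_ifs at h0 <;> norm_num at h0
          · exact h0
        rw [this]; simp
      · have := main p hp q hq (by rw [← neg_sub, mul_neg]; linarith)
        have e2 : (p (i + 1) - q (i + 1)) - k * (κ / 2) * (p i - q i)
            = -((q (i + 1) - p (i + 1)) - k * (κ / 2) * (q i - p i)) := by ring
        rwa [abs_sub_comm (p i), e2, abs_neg]
  have hcard : (J.card : ℝ) ≤ 4 * (4 / κ + 3) * (2 * (d / h) + 3) := by
    have c1 := card_Icc_neg_ceil_le (y := 2 / κ) (by positivity)
    have c2 := card_Icc_neg_ceil_le (y := d / h) (by positivity)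
    have hJc : J.card = 2 * (2 * ((Finset.Icc (-⌈2 / κ⌉) ⌈2 / κ⌉).card
        * (Finset.Icc (-⌈d / h⌉) ⌈d / h⌉).card)) := by
      rw [hJ, Finset.card_product, Finset.card_product, Finset.card_product]; rfl
    rw [hJc, Nat.cast_mul, Nat.cast_mul, Nat.cast_mul]
    generalize (Finset.Icc (-⌈2 / κ⌉) ⌈2 / κ⌉).card = m at c1 ⊢
    generalize (Finset.Icc (-⌈d / h⌉) ⌈d / h⌉).card = n at c2 ⊢
    calc ((2 : ℕ) : ℝ) * ((2 : ℕ) * ((m : ℝ) * n)) = 4 * (m : ℝ) * n := by push_cast; ring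
      _ ≤ 4 * (2 * (2 / κ) + 3) * (2 * (d / h) + 3) := by gcongr
      _ = _ := by ring
  calc Measure.hausdorffMeasure 1 (B ∩ K) ≤ _ := measure_mono hcover
    _ ≤ ∑ c ∈ J, Measure.hausdorffMeasure 1 (A c) := measure_biUnion_finset_le _ _
    _ ≤ ∑ _c ∈ J, ENNReal.ofReal (21 * d / κ) := Finset.sum_le_sum hpiece
    _ = ENNReal.ofReal (J.card * (21 * d / κ)) := by
        rw [Finset.sum_const, nsmul_eq_mul, ENNReal.ofReal_mul (by positivity),
          ENNReal.ofReal_natCast]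
    _ ≤ _ := by
        apply ENNReal.ofReal_le_ofReal
        gcongr

/-! ### Assembling the constants -/

/-- A quantitative form of the perimeter bound. -/
theorem IsGeodesicallyConvexIn.perimeter_le_of_isCovered {α β : ℝ} (hα : 0 < α) (hβ : 0 < β)
    {P R : Set Plane} (hP : IsPolygonalDomain P) (hPc : IsCovered α β P)
    (hR : IsGeodesicallyConvexIn P R) (hRP : IsSegmentUnion (closure (frontier R \ frontier P))) :
    perimeter R ≤ ENNReal.ofReal (37052 * 1728 * (1 / (β * α ^ 3)) * Metric.diam R) := by
  have hbP := hP.isCompact.isBounded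
  have hbR : Bornology.IsBounded R := hbP.subset hR.1
  obtain ⟨p, hp⟩ : (frontier P).Nonempty := by
    refine nonempty_frontier_iff.2 ⟨hP.isConnected.nonempty, fun e => ?_⟩
    exact noncompact_univ Plane (e ▸ hP.isCompact)
  obtain ⟨a, b, hT, hTP, hs, -, -⟩ := hPc p hp
  have hdist : 0 < dist p a ∧ dist p a ≤ Metric.diam P :=
    ⟨dist_pos.2 hT.ne.1, Metric.dist_le_diam_of_mem hbP
      (hTP (subset_convexHull ℝ _ (by simp))) (hTP (subset_convexHull ℝ _ (by simp)))⟩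
  have hD : 0 < Metric.diam P := hdist.1.trans_le hdist.2
  have hβ1 : β ≤ 1 := by
    by_contra! hlt
    nlinarith
  have hα3 := hT.le_pi_div_three
  set κ := Real.sin α / 6 with hκ
  -- Jordan's inequality, with π ≤ 4.
  have hκα : α / 12 ≤ κ := by
    have h1 := Real.mul_le_sin hα.le (by linarith [Real.pi_pos])
    have h2 : 1 / 2 ≤ 2 / Real.pi := by
      rw [div_le_div_iff₀ two_pos Real.pi_pos]; linarith [Real.pi_le_four]
    have h3 : 1 / 2 * α ≤ Real.sin α := le_trans (by gcongr) h1
    rw [hκ]; linarith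
  have hκ0 : 0 < κ := by linarith
  have hκ1 : κ ≤ 1 := by rw [hκ]; linarith [Real.sin_le_one α]
  set d := Metric.diam R with hd
  have hd0 : 0 ≤ d := Metric.diam_nonneg
  have hdD : d ≤ Metric.diam P := Metric.diam_mono hR.1 hbP
  set K := closure (convexHull ℝ R) with hK
  have hbK : Bornology.IsBounded K := (isBounded_convexHull.2 hbR).closure
  have hKd : Metric.diam K = d := by rw [hK, Metric.diam_closure, convexHull_diam]
  have hKc : IsCompact K := Metric.isCompact_of_isClosed_isBounded isClosed_closure hbK
  have hed : Metric.ediam K = ENNReal.ofReal d := by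
    rw [← hKd, Metric.diam, ENNReal.ofReal_toReal hbK.ediam_ne_top]
  have hF := (hPc.hasEmptyCones hα).hausdorffMeasure_le (d := d) (K := K) hκ0 hκ1
    (by positivity) hd0 (fun p hp q hq => hKd ▸ Metric.dist_le_diam_of_mem hbK hp hq)
  -- Here 4116 = 4 · 7 · 7 · 21. As d ≤ diam P, the number of slabs is bounded in terms of κβ alone.
  have hfour : 4 * (4 / κ + 3) * (2 * (d / (κ * (β * Metric.diam P) / 2)) + 3) * (21 * d / κ)
      ≤ 4116 / (β * κ ^ 3) * d := by
    have hκi : 1 ≤ 1 / κ := by rw [le_div_iff₀ hκ0]; linarith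
    have hκβ : 1 ≤ 1 / (κ * β) := by
      rw [le_div_iff₀ (by positivity)]; nlinarith
    have f1 : 4 / κ + 3 ≤ 7 * (1 / κ) := by
      have : 4 / κ = 4 * (1 / κ) := by ring
      linarith
    have f2 : 2 * (d / (κ * (β * Metric.diam P) / 2)) + 3 ≤ 7 * (1 / (κ * β)) := by
      have : d / (κ * (β * Metric.diam P) / 2) ≤ 2 * (1 / (κ * β)) := by
        rw [div_le_iff₀ (by positivity)]
        calc d ≤ Metric.diam P := hdD
          _ = _ := by field_simp
      linarith
    calc _ ≤ 4 * (7 * (1 / κ)) * (7 * (1 / (κ * β))) * (21 * d / κ) := by gcongr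
      _ = _ := by field_simp; ring
  have hper := hR.perimeter_le hP hRP (convex_convexHull ℝ R).closure hKc
    (closure_mono (subset_convexHull ℝ R))
  refine hper.trans ?_
  rw [← hK, hed]
  calc 9 * Measure.hausdorffMeasure 1 (frontier P ∩ K) + 8 * ENNReal.ofReal d
      ≤ 9 * ENNReal.ofReal (4116 / (β * κ ^ 3) * d) + 8 * ENNReal.ofReal d := by
        gcongr
        exact hF.trans (ENNReal.ofReal_le_ofReal hfour)
    _ = ENNReal.ofReal (9 * (4116 / (β * κ ^ 3) * d) + 8 * d) := by
        rw [ENNReal.ofReal_add (by positivity) (by positivity), ENNReal.ofReal_mul (p := 9) (by norm_num),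
          ENNReal.ofReal_mul (p := 8) (by norm_num)]
        norm_num
    _ ≤ _ := by
        apply ENNReal.ofReal_le_ofReal
        -- Absorbs the term 8d, giving 37052 = 9 · 4116 + 8; the factor 1728 = 12³ comes from κ ≥
        -- α/12.
        have g1 : 1 ≤ 1 / (β * κ ^ 3) := by
          rw [le_div_iff₀ (by positivity), one_mul]
          exact mul_le_one₀ hβ1 (by positivity) (pow_le_one₀ hκ0.le hκ1)
        have g2 : 1 / (β * κ ^ 3) ≤ 1728 * (1 / (β * α ^ 3)) := by
          calc 1 / (β * κ ^ 3) ≤ 1 / (β * (α / 12) ^ 3) := by gcongr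
            _ = _ := by field_simp; norm_num
        calc 9 * (4116 / (β * κ ^ 3) * d) + 8 * d
            = (37044 * (1 / (β * κ ^ 3)) + 8) * d := by ring
          _ ≤ (37052 * 1728 * (1 / (β * α ^ 3))) * d := by
            gcongr
            linarith

end FatDomain

theorem mainTheorem3 :
    ∃ ν : ℝ → ℝ → ℝ,
      (∃ c : ℝ, 0 < c ∧ ∀ α β : ℝ, 0 < α → 0 < β →
        0 < ν α β ∧ ν α β ≤ c * (1 / (β * α ^ 3))) ∧
      ∀ α β : ℝ, 0 < α → 0 < β →
        ∀ P R : Set FatDomain.Plane,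
          FatDomain.IsPolygonalDomain P →
          FatDomain.IsCovered α β P →
          FatDomain.IsGeodesicallyConvexIn P R →
          FatDomain.IsSegmentUnion (closure (frontier R \ frontier P)) →
          FatDomain.perimeter R ≤ ENNReal.ofReal (ν α β * Metric.diam R) := by
  refine ⟨fun α β => 37052 * 1728 * (1 / (β * α ^ 3)), ⟨37052 * 1728, by norm_num,
    fun α β hα hβ => ⟨by positivity, le_rfl⟩⟩, fun α β hα hβ P R hP hPc hR hRP => ?_⟩
  exact hR.perimeter_le_of_isCovered hα hβ hP hPc hRP
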